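/- **Setting.** Graphs are finite, simple and undirected, with node features $X_v\in\mathbb R^F$. Fix one of the two conventions for neighbourhoods, $\mathcal N(v)=\{w : \mathrm{dist}(v,w)\le 1\}$ (which contains $v$) or $\mathcal N(v)=\{w : w \text{ adjacent to } v\}$; everything below holds for both. For a hash function $\mathcal H:\mathcal V\to[n]$ the Bloom signature $\mathbf s_v\in\{0,1\}^n$ of $\mathcal N(v)$ has $\mathbf s_v[j]=1$ iff $\mathcal H(w)=j$ for some $w\in\mathcal N(v)$. Write $\|$ for concatenation. A *standard MPNN* computes $\mathbf h^{(0)}_v=X_v$, $\mathbf h^{(l)}_v=\sigma^{(l)}\big(\mathbf h^{(l-1)}_v,\mathrm{AGG}^{(l)}\{\!\!\{\phi^{(l)}(\mathbf h^{(l-1)}_v,\mathbf h^{(l-1)}_w) : w\in\mathcal N(v)\}\!\!\}\big)$ for $l=1,\dots,L$, and scores the pair $(u,v)$ by $\mathrm{sigmoid}(\rho(\mathbf h_u\circ\mathbf h_v))$ with a decoder $\circ$ and a real-valued readout function $\rho$. An *MPNN with Bloom signatures* computes $\mathbf h^{(0)}_v=X_v$ and $$\mathbf h^{(l)}_v=\sigma^{(l)}\big(\mathbf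 h^{(l-1)}_v,\mathrm{AGG}^{(l)}\{\!\!\{\phi^{(l)}(\mathbf h^{(l-1)}_w,\mathbf h^{(l-1)}_v,\mathbf e_{w,v}) : w\in\mathcal N(v)\}\!\!\}\big),\qquad \mathbf e_{w,v}=\psi(\mathbf s_w\|\mathbf s_v),$$ has the pair representations $\rho\big((\mathbf h_u\circ\mathbf h_v)\,\|\,\hat S(\mathbf s_u\|\mathbf s_v)\big)$, and scores the pair $(u,v)$ by the sigmoid of its (then real-valued) pair representation; for graph-level output, the representations of all ordered node pairs are pooled and passed through a further real-valued readout. Such a model is called *neural* if $\phi^{(l)},\sigma^{(l)},\psi,\hat S,\rho$ and the graph-level readout (those which the model has) are ReLU multilayer perceptrons, each $\mathrm{AGG}^{(l)}$ and the pooling is a sum, mean or entrywise maximum, and $\circ$ is the dot product, Hadamard product or concatenation; without this word these are arbitrary functions. **Proposition.** Let $n,F\ge 0$. 1. *(At least as expressive as standard MPNNs and 1-WL.)* For every standard MPNN there is an MPNN with Bloom signatures of length $n$, neural if the given MPNN is neural, that gives the same scores to all node pairs of all graphs, for every $\mathcal H$. Moreover, if after some number of rounds 1-WL (with initial colours $X_v$)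 gives different ordered pairs of colours to the pairs $(u,v)$ in $\mathcal G$ and $(u',v')$ in $\mathcal G'$, then some neural MPNN with Bloom signatures gives different scores to them, for all hash functions on $\mathcal G$ and $\mathcal G'$. 2. *(Strictly more expressive.)* Let $\mathcal G$ be the 3-regular graph on $v_1,\dots,v_8$ with edges $v_1v_2,v_1v_7,v_1v_8,v_2v_3,v_2v_4,v_3v_4,v_3v_6,v_4v_5,v_5v_6,v_5v_8,v_6v_7,v_7v_8$, with all node features equal. There is an automorphism of $\mathcal G$ mapping $v_4$ to $v_7$ (and trivially one mapping $v_1$ to $v_1$), but none mapping $(v_1,v_4)$ to $(v_1,v_7)$. Neither 1-WL nor any standard MPNN separates $(v_1,v_4)$ from $(v_1,v_7)$. But there is a neural MPNN with Bloom signatures of length $n$ such that, for all feature values and all injective (collision-free) hash functions $\mathcal H,\mathcal H':\mathcal V\to[n]$, the score of $(v_1,v_4)$ under $\mathcal H$ differs from the score of $(v_1,v_7)$ under $\mathcal H'$. 3. *(Not less powerful than 3-WL.)* The Shrikhande graph and the $4\times4$ Rook's graph are not isomorphic, and the (non-folklore) 3-WL algorithm does not distinguish them. But there is a neural MPNN with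 Bloom signatures of length $n$ and graph-level readout whose outputs on the two graphs (with all node features equal to one common vector) differ, for all values of that vector and all injective hash functions to $[n]$ on the two graphs. -/

import Mathlib

noncomputable section

namespace BloomMPNN

/-- Real vectors of length `d`; concatenation `x || y` is `Fin.append x y`. -/
abbrev Vec (d : ℕ) := Fin d → ℝ

section Components

/-- Entrywise ReLU. -/
def relu {d : ℕ} (x : Vec d) : Vec d := fun i => max (x i) 0

/-- The functions computed by multilayer perceptrons with ReLU activations (any depth, any widths,
linear output layer). -/
inductive IsMLP {a : ℕ} : {b : ℕ} → (Vec a → Vec b) → Prop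
  | affine {b : ℕ} (W : Matrix (Fin b) (Fin a) ℝ) (c : Vec b) :
      IsMLP (fun x => W.mulVec x + c)
  | layer {b b' : ℕ} {f : Vec a → Vec b} (hf : IsMLP f) (W : Matrix (Fin b') (Fin b) ℝ)
      (c : Vec b') : IsMLP (fun x => W.mulVec (relu (f x)) + c)

/-- The usual permutation-invariant aggregations: sum, mean and entrywise maximum. -/
inductive IsAggregator {m : ℕ} : (Multiset (Vec m) → Vec m) → Prop
  | sum : IsAggregator (fun s => s.sum)
  | mean : IsAggregator (fun s => (s.card : ℝ)⁻¹ • s.sum)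
  | max : IsAggregator (fun s i => sSup {y | ∃ x ∈ s, x i = y})

/-- The usual decoders for link prediction: dot product, Hadamard product and concatenation. -/
inductive IsDecoder {d : ℕ} : {k : ℕ} → (Vec d → Vec d → Vec k) → Prop
  | dot : IsDecoder (fun x y => (fun _ => x ⬝ᵥ y : Vec 1))
  | hadamard : IsDecoder (fun x y => x * y)
  | concat : IsDecoder (fun x y => Fin.append x y)

end Components

section Graphs

variable {V V' : Type} [Fintype V] [Fintype V']

open Classical in
/-- The neighbourhood `N(v)`. With `loops = true` it consists of all nodes at shortest path distance
at most 1 from `v`, including `v` itself; with `loops = false` the node `v` is left out. -/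
def nbhd (loops : Bool) (G : SimpleGraph V) (v : V) : Finset V :=
  Finset.univ.filter fun w => G.Adj v w ∨ (loops = true ∧ w = v)

open Classical in
/-- The Bloom signature `s_v ∈ {0,1}^n` of `N(v)` for the hash function `H : V → [n]`. -/
def bloomSig {n : ℕ} (loops : Bool) (G : SimpleGraph V) (H : V → Fin n) (v : V) : Vec n :=
  fun j => if ∃ w ∈ nbhd loops G v, H w = j then 1 else 0

/-- `u ∼_G v` for nodes. -/
def AutNodes (G : SimpleGraph V) (u v : V) : Prop := ∃ π : G ≃g G, π u = v

/-- `(u₁, v₁) ∼_G (u₂, v₂)` for node pairs. -/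
def AutPairs (G : SimpleGraph V) (e₁ e₂ : V × V) : Prop :=
  ∃ π : G ≃g G, π e₁.1 = e₂.1 ∧ π e₁.2 = e₂.2

/-! ### Weisfeiler-Leman algorithms -/

/-- Colours after `t` rounds of 1-WL; the initial colours are the node features. -/
def WL1Color (F : ℕ) : ℕ → Type
  | 0 => Vec F
  | t + 1 => WL1Color F t × Multiset (WL1Color F t)

open Classical in
/-- Colour refinement (1-WL). -/
def wl1 {F : ℕ} (G : SimpleGraph V) (X : V → Vec F) : (t : ℕ) → V → WL1Color F t
  | 0, v => X v
  | t + 1, v =>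
      (wl1 G X t v, (Finset.univ.filter fun w => G.Adj v w).val.map fun w => wl1 G X t w)

/-- 1-WL gives different colours to the two ordered node pairs (of possibly different graphs). -/
def WL1Separates {F : ℕ} (G : SimpleGraph V) (X : V → Vec F) (e : V × V)
    (G' : SimpleGraph V') (X' : V' → Vec F) (e' : V' × V') : Prop :=
  ∃ t, (wl1 G X t e.1, wl1 G X t e.2) ≠ (wl1 G' X' t e'.1, wl1 G' X' t e'.2)

/-- Colours of `k`-tuples after `t` rounds of `k`-WL. -/
def WLColor (k : ℕ) : ℕ → Type
  | 0 => Fin k → Fin k → Prop × Prop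
  | t + 1 => WLColor k t × (Fin k → Multiset (WLColor k t))

/-- The `k`-dimensional Weisfeiler-Leman algorithm on `k`-tuples, `k ≥ 2` (the standard,
non-folklore version). The initial colour is the isomorphism type of the ordered induced subgraph.
In each round, for each position `i`, the multiset of the colours of the tuples
that arise by replacing the `i`-th entry is added. -/
def wl (k : ℕ) (G : SimpleGraph V) : (t : ℕ) → (Fin k → V) → WLColor k t
  | 0, a => fun i j => (a i = a j, G.Adj (a i) (a j))
  | t + 1, a =>
      (wl k G t a, fun i => Finset.univ.val.map fun w => wl k G t (Function.update a i w))

open Classical in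
/-- `k`-WL does not distinguish the two graphs: after any number of rounds, the multisets of
colours of all `k`-tuples agree. -/
def WLEquiv (k : ℕ) (G : SimpleGraph V) (G' : SimpleGraph V') : Prop :=
  ∀ t, (Finset.univ : Finset (Fin k → V)).val.map (wl k G t) =
    (Finset.univ : Finset (Fin k → V')).val.map (wl k G' t)

end Graphs

/-! ### Standard MPNN -/

/-- A message passing layer:
`h_v' = upd (h_v || agg {{ phi (h_v || h_w) | w ∈ N(v) }})`. -/
structure MPLayer (d d' : ℕ) where
  m : ℕ
  phi : Vec (d + d) → Vec m
  agg : Multiset (Vec m) → Vec m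
  upd : Vec (d + m) → Vec d'

/-- The layer is built from MLPs and a usual aggregation. -/
def MPLayer.IsNeural {d d' : ℕ} (l : MPLayer d d') : Prop :=
  IsMLP l.phi ∧ IsAggregator l.agg ∧ IsMLP l.upd

/-- A finite sequence of message passing layers, from node features in `ℝ^F` to `ℝ^d`. -/
inductive MPStack (F : ℕ) : ℕ → Type
  | input : MPStack F F
  | layer {d d' : ℕ} (prev : MPStack F d) (l : MPLayer d d') : MPStack F d'

def MPStack.IsNeural {F : ℕ} : {d : ℕ} → MPStack F d → Prop
  | _, .input => True
  | _, .layer prev l => prev.IsNeural ∧ l.IsNeural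

/-- The node representations `h_v`. -/
def MPStack.eval {F : ℕ} {V : Type} [Fintype V] (loops : Bool) (G : SimpleGraph V)
    (X : V → Vec F) : {d : ℕ} → MPStack F d → V → Vec d
  | _, .input, v => X v
  | _, .layer prev l, v =>
      l.upd (Fin.append (prev.eval loops G X v)
        (l.agg ((nbhd loops G v).val.map fun w =>
          l.phi (Fin.append (prev.eval loops G X v) (prev.eval loops G X w)))))

/-- A standard MPNN for link prediction: message passing layers, a decoder and a head. -/
structure MPNN (F : ℕ) where
  d : ℕ
  layers : MPStack F d
  k : ℕ
  dec : Vec d → Vec d → Vec k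
  head : Vec k → Vec 1

/-- All learnable parts are MLPs; aggregations and decoder are usual ones. -/
def MPNN.IsNeural {F : ℕ} (M : MPNN F) : Prop :=
  M.layers.IsNeural ∧ IsDecoder M.dec ∧ IsMLP M.head

/-- The predicted likelihood `sigmoid (head (h_u ∘ h_v))` of the link `(u, v)`. -/
def MPNN.score {F : ℕ} (M : MPNN F) {V : Type} [Fintype V] (loops : Bool) (G : SimpleGraph V)
    (X : V → Vec F) (u v : V) : ℝ :=
  Real.sigmoid (M.head (M.dec (M.layers.eval loops G X u) (M.layers.eval loops G X v)) 0)

/-! ### MPNN with Bloom signatures -/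

/-- A message passing layer with edge features in `ℝ^e`:
`h_v' = upd (h_v || agg {{ phi (h_w || h_v || e_{w,v}) | w ∈ N(v) }})`. -/
structure BloomLayer (e d d' : ℕ) where
  m : ℕ
  phi : Vec (d + d + e) → Vec m
  agg : Multiset (Vec m) → Vec m
  upd : Vec (d + m) → Vec d'

def BloomLayer.IsNeural {e d d' : ℕ} (l : BloomLayer e d d') : Prop :=
  IsMLP l.phi ∧ IsAggregator l.agg ∧ IsMLP l.upd

inductive BloomStack (e F : ℕ) : ℕ → Type
  | input : BloomStack e F F
  | layer {d d' : ℕ} (prev : BloomStack e F d) (l : BloomLayer e d d') : BloomStack e F d'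

def BloomStack.IsNeural {e F : ℕ} : {d : ℕ} → BloomStack e F d → Prop
  | _, .input => True
  | _, .layer prev l => prev.IsNeural ∧ l.IsNeural

/-- The node representations `h_v` for given edge features `E w v = e_{w,v}`. -/
def BloomStack.eval {e F : ℕ} {V : Type} [Fintype V] (loops : Bool) (G : SimpleGraph V)
    (E : V → V → Vec e) (X : V → Vec F) : {d : ℕ} → BloomStack e F d → V → Vec d
  | _, .input, v => X v
  | _, .layer prev l, v =>
      l.upd (Fin.append (prev.eval loops G E X v)
        (l.agg ((nbhd loops G v).val.map fun w =>
          l.phi (Fin.append (Fin.append (prev.eval loops G E X w) (prev.eval loops G E X v))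
            (E w v)))))

/-- An MPNN with Bloom signatures of length `n` and node pair representations in `ℝ^r`:
`psi` is the encoder of the edge features `e_{w,v} = psi (s_w || s_v)`, and `sHat` computes the
pairwise structural features from `s_u || s_v`. -/
structure BloomNet (n F r : ℕ) where
  e : ℕ
  psi : Vec (n + n) → Vec e
  d : ℕ
  layers : BloomStack e F d
  k : ℕ
  dec : Vec d → Vec d → Vec k
  p : ℕ
  sHat : Vec (n + n) → Vec p
  head : Vec (k + p) → Vec r

/-- All learnable parts are MLPs; aggregations and decoder are usual ones. -/
def BloomNet.IsNeural {n F r : ℕ} (M : BloomNet n F r) : Prop :=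
  IsMLP M.psi ∧ M.layers.IsNeural ∧ IsDecoder M.dec ∧ IsMLP M.sHat ∧ IsMLP M.head

section BloomEval

variable {n F : ℕ} {V : Type} [Fintype V]

/-- The node representations `h_v`. -/
def BloomNet.node {r : ℕ} (M : BloomNet n F r) (loops : Bool) (G : SimpleGraph V) (X : V → Vec F)
    (H : V → Fin n) (v : V) : Vec M.d :=
  M.layers.eval loops G
    (fun w v => M.psi (Fin.append (bloomSig loops G H w) (bloomSig loops G H v))) X v

/-- The node pair representation `head (h_u ∘ h_v || Ŝ(u, v))`. -/
def BloomNet.pair {r : ℕ} (M : BloomNet n F r) (loops : Bool) (G : SimpleGraph V) (X : V → Vec F)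
    (H : V → Fin n) (u v : V) : Vec r :=
  M.head (Fin.append (M.dec (M.node loops G X H u) (M.node loops G X H v))
    (M.sHat (Fin.append (bloomSig loops G H u) (bloomSig loops G H v))))

/-- The predicted likelihood `sigmoid (head (h_u ∘ h_v || Ŝ(u, v)))` of the link `(u, v)`. -/
def BloomNet.score (M : BloomNet n F 1) (loops : Bool) (G : SimpleGraph V) (X : V → Vec F)
    (H : V → Fin n) (u v : V) : ℝ :=
  Real.sigmoid (M.pair loops G X H u v 0)

end BloomEval

/-- An MPNN with Bloom signatures with a graph-level readout: the representations of all
ordered node pairs are pooled and passed to `readout`. -/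
structure BloomGraphNet (n F : ℕ) where
  r : ℕ
  net : BloomNet n F r
  pool : Multiset (Vec r) → Vec r
  readout : Vec r → Vec 1

def BloomGraphNet.IsNeural {n F : ℕ} (M : BloomGraphNet n F) : Prop :=
  M.net.IsNeural ∧ IsAggregator M.pool ∧ IsMLP M.readout

def BloomGraphNet.output {n F : ℕ} {V : Type} [Fintype V] (M : BloomGraphNet n F) (loops : Bool)
    (G : SimpleGraph V) (X : V → Vec F) (H : V → Fin n) : ℝ :=
  M.readout (M.pool ((Finset.univ : Finset (V × V)).val.map
    fun q => M.net.pair loops G X H q.1 q.2)) 0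

/-! ### The graphs -/

/-- The 3-regular graph on eight nodes; `v_i` is the element `i - 1` of `Fin 8`. -/
def cubicGraph : SimpleGraph (Fin 8) :=
  SimpleGraph.fromRel fun a b => (a, b) ∈ ([(0, 1), (0, 6), (0, 7), (1, 2), (1, 3), (2, 3), (2, 5),
    (3, 4), (4, 5), (4, 7), (5, 6), (6, 7)] : List (Fin 8 × Fin 8))

/-- The Shrikhande graph: the Cayley graph of `ℤ/4 × ℤ/4` with connection set
`{±(1,0), ±(0,1), ±(1,1)}`. -/
def shrikhande : SimpleGraph (ZMod 4 × ZMod 4) :=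
  SimpleGraph.fromRel fun a b => b - a ∈ ([(1, 0), (0, 1), (1, 1)] : List (ZMod 4 × ZMod 4))

/-- The 4 × 4 Rook's graph: two different squares are adjacent if they share a row or a column. -/
def rook : SimpleGraph (Fin 4 × Fin 4) :=
  SimpleGraph.fromRel fun a b => a.1 = b.1 ∨ a.2 = b.2

end BloomMPNN

end

open BloomMPNN

/-! ReLU MLPs are closed under composition, concatenation, linear combinations and positive parts
(`IsMLP.comp`, `IsMLP.append`, the `IsScalarMLP` lemmas), so every network below can be given by an
explicit formula. Standard MPNNs embed by ignoring the signatures (`MPNN.score_toBloom`). For 1-WL,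
only finitely many node states occur on two fixed graphs; MLPs can be the indicators of these states
there, and sum aggregation then yields the number of neighbours in each state, which determines the
refined colour (`exists_stack_refines_wl1`).

In the cubic graph, regularity and constant features keep all 1-WL colours and all MPNN states
constant, yet `v₁v₇` is an edge and `v₁v₄` is not. Under an injective hash the signatures are the
rows of the matrix `A` of the relation `w ∈ N(v)`, with columns relabelled. One round of summing the
`s_w` gives the row of `A²` at each node. The network does not know which coordinate belongs to `u`,
but in the row of `u = v₁` the diagonal entry is the largest, so a threshold marks that coordinate;
reading `s_v` there decides whether `u ∈ N(v)` (`pair_memNet`).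

The Shrikhande and Rook's graphs are strongly regular with the same parameters, so 3-WL never
refines the isomorphism types of triples (`PairExtension.wlEquiv`). Only the Rook's graph contains a
4-clique. Messages that combine `s_w` and `s_v` provide counts indexed by pairs of coordinates; with
the same marking of `u`, sum pooling counts 4-cliques (`output_cliqueNet`). -/

namespace BloomMPNN
open Matrix

/-! ### Closure properties of ReLU MLPs -/

section MLP

variable {a : ℕ}

/-- The output layer has no activation, so a further affine map is absorbed into it. -/
theorem IsMLP.linear {b c : ℕ} {f : Vec a → Vec b} (hf : IsMLP f) (W : Matrix (Fin c) (Fin b) ℝ)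
    (w : Vec c) : IsMLP fun x => W.mulVec (f x) + w := by
  cases hf with
  | affine U u =>
    convert IsMLP.affine (W * U) (W.mulVec u + w) using 2 with x
    rw [mulVec_add, mulVec_mulVec, add_assoc]
  | layer hf U u =>
    convert IsMLP.layer hf (W * U) (W.mulVec u + w) using 2 with x
    rw [mulVec_add, mulVec_mulVec, add_assoc]

theorem IsMLP.id : IsMLP (fun x : Vec a => x) := by
  simpa using IsMLP.affine (1 : Matrix (Fin a) (Fin a) ℝ) 0

theorem IsMLP.comp {b c : ℕ} {g : Vec b → Vec c} {f : Vec a → Vec b} (hg : IsMLP g)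
    (hf : IsMLP f) : IsMLP fun x => g (f x) := by
  induction hg with
  | affine W w => exact hf.linear W w
  | layer _ W w ih => exact IsMLP.layer ih W w

theorem IsMLP.relu {b : ℕ} {f : Vec a → Vec b} (hf : IsMLP f) :
    IsMLP fun x => BloomMPNN.relu (f x) := by
  simpa using IsMLP.layer hf (1 : Matrix (Fin b) (Fin b) ℝ) 0

/-- Selecting coordinates is an affine map. -/
theorem IsMLP.coords {b c : ℕ} {f : Vec a → Vec b} (hf : IsMLP f) (σ : Fin c → Fin b) :
    IsMLP fun x i => f x (σ i) := by
  convert hf.linear (Matrix.of fun i j => if σ i = j then 1 else 0) 0 using 2 with x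
  ext i
  simp [mulVec, dotProduct]

/-- The identity is a linear map of the ReLU of a linear map. -/
theorem exists_mulVec_relu_append_neg (b : ℕ) :
    ∃ D : Matrix (Fin b) (Fin (b + b)) ℝ, ∀ y : Vec b,
      D.mulVec (BloomMPNN.relu (Fin.append y (-y))) = y := by
  refine ⟨Matrix.of fun i j => Fin.addCases (fun k => if i = k then (1 : ℝ) else 0)
    (fun k => if i = k then -1 else 0) j, fun y => ?_⟩
  ext i
  simp only [mulVec, dotProduct, Fin.sum_univ_add, of_apply, Fin.addCases_left,
    Fin.addCases_right, BloomMPNN.relu, Fin.append_left, Fin.append_right]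
  simp only [Pi.neg_apply, ite_mul, one_mul, zero_mul, neg_mul, Finset.sum_ite_eq, Finset.mem_univ,
    if_true]
  rcases le_total (y i) 0 with h | h
  · simp [max_eq_right h, max_eq_left (neg_nonneg.2 h)]
  · simp [max_eq_left h, max_eq_right (neg_nonpos.2 h)]

/-- Block diagonal matrices act blockwise. -/
theorem exists_blockDiag {b c b' c' : ℕ} (W : Matrix (Fin b') (Fin b) ℝ)
    (U : Matrix (Fin c') (Fin c) ℝ) :
    ∃ D : Matrix (Fin (b' + c')) (Fin (b + c)) ℝ, ∀ x y,
      D.mulVec (Fin.append x y) = Fin.append (W.mulVec x) (U.mulVec y) := by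
  refine ⟨(fromBlocks W 0 0 U).submatrix finSumFinEquiv.symm finSumFinEquiv.symm, fun x y => ?_⟩
  ext i
  refine Fin.addCases (fun i => ?_) (fun i => ?_) i <;>
  simp [mulVec, dotProduct, Fin.sum_univ_add]

theorem append_add {b c : ℕ} (x x' : Vec b) (y y' : Vec c) :
    Fin.append x y + Fin.append x' y' = Fin.append (x + x') (y + y') := by
  ext i
  refine Fin.addCases (fun i => ?_) (fun i => ?_) i <;> simp

theorem relu_append {b c : ℕ} (x : Vec b) (y : Vec c) :
    BloomMPNN.relu (Fin.append x y) = Fin.append (BloomMPNN.relu x) (BloomMPNN.relu y) := by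
  ext i
  refine Fin.addCases (fun i => ?_) (fun i => ?_) i <;> simp [BloomMPNN.relu]

theorem IsMLP.affine_append_affine {b c : ℕ} (W : Matrix (Fin b) (Fin a) ℝ) (w : Vec b)
    (U : Matrix (Fin c) (Fin a) ℝ) (u : Vec c) :
    IsMLP fun x => Fin.append (W.mulVec x + w) (U.mulVec x + u) := by
  convert IsMLP.affine ((fromRows W U).submatrix finSumFinEquiv.symm _root_.id) (Fin.append w u)
    using 2 with x
  ext i
  refine Fin.addCases (fun i => ?_) (fun i => ?_) i <;> simp [mulVec, dotProduct]

theorem IsMLP.layer_append_layer {b c b' c' : ℕ} {f : Vec a → Vec b} {g : Vec a → Vec c}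
    (h : IsMLP fun x => Fin.append (f x) (g x)) (W : Matrix (Fin b') (Fin b) ℝ) (w : Vec b')
    (U : Matrix (Fin c') (Fin c) ℝ) (u : Vec c') :
    IsMLP fun x => Fin.append (W.mulVec (BloomMPNN.relu (f x)) + w)
      (U.mulVec (BloomMPNN.relu (g x)) + u) := by
  obtain ⟨D, hD⟩ := exists_blockDiag W U
  convert IsMLP.layer h D (Fin.append w u) using 2 with x
  rw [relu_append, hD, append_add]

/-- An affine map is an affine map of the ReLU of an affine map. -/
theorem exists_affine_eq_layer {b : ℕ} (W : Matrix (Fin b) (Fin a) ℝ) (w : Vec b) :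
    ∃ (c : ℕ) (U : Matrix (Fin c) (Fin a) ℝ) (u : Vec c) (D : Matrix (Fin b) (Fin c) ℝ),
      (fun x => W.mulVec x + w) = fun x => D.mulVec (BloomMPNN.relu (U.mulVec x + u)) + 0 := by
  obtain ⟨D, hD⟩ := exists_mulVec_relu_append_neg b
  refine ⟨b + b, (fromRows W (-W)).submatrix finSumFinEquiv.symm _root_.id, Fin.append w (-w), D,
    funext fun x => ?_⟩
  rw [add_zero]
  convert (hD (W.mulVec x + w)).symm using 3
  ext i
  refine Fin.addCases (fun i => ?_) (fun i => ?_) i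
  · simp [mulVec, dotProduct]
  · simp [mulVec, dotProduct, add_comm, -Fin.natAdd_eq_addNat]

/-- Two networks run in parallel with block diagonal weights. If their depths differ, the shallower
one is lengthened at its affine bottom, where `y = relu y - relu (-y)` lets an affine map pass
through an additional ReLU layer. -/
theorem IsMLP.append {b c : ℕ} {f : Vec a → Vec b} {g : Vec a → Vec c} (hf : IsMLP f)
    (hg : IsMLP g) : IsMLP fun x => Fin.append (f x) (g x) := by
  induction hf generalizing c with
  | @affine b W w =>
    induction hg generalizing b with
    | affine U u => exact IsMLP.affine_append_affine W w U u
    | layer hg U u ih =>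
      obtain ⟨k, W', w', D, h⟩ := exists_affine_eq_layer W w
      simp only [congrFun h]
      exact IsMLP.layer_append_layer (ih W' w') D 0 U u
  | layer hf W w ih =>
    cases hg with
    | affine U u =>
      obtain ⟨k, U', u', D, h⟩ := exists_affine_eq_layer U u
      simp only [congrFun h]
      exact IsMLP.layer_append_layer (ih (IsMLP.affine U' u')) W w D 0
    | layer hg U u => exact IsMLP.layer_append_layer (ih hg) W w U u

/-- Real-valued functions computed by an MLP. -/
def IsScalarMLP (f : Vec a → ℝ) : Prop := IsMLP fun x (_ : Fin 1) => f x

/-- A function is an MLP if all its entries are. -/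
theorem IsMLP.pi {b : ℕ} {f : Vec a → Vec b} (hf : ∀ i, IsScalarMLP fun x => f x i) :
    IsMLP f := by
  induction b with
  | zero =>
    convert IsMLP.affine (0 : Matrix (Fin 0) (Fin a) ℝ) 0 using 2
  | succ b ih =>
    have h := (ih fun i => hf i.castSucc).append (hf (Fin.last b))
    convert h using 2 with x
    ext i
    refine Fin.lastCases ?_ (fun i => ?_) i
    · exact (Fin.append_right (fun i => f x (Fin.castSucc i)) (fun _ => f x (Fin.last b)) 0).symm
    · exact (Fin.append_left (fun i => f x (Fin.castSucc i)) (fun _ => f x (Fin.last b)) i).symm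

theorem IsMLP.scalar {b : ℕ} {f : Vec a → Vec b} (hf : IsMLP f) (i : Fin b) :
    IsScalarMLP fun x => f x i :=
  hf.coords fun _ => i

theorem IsScalarMLP.coord (i : Fin a) : IsScalarMLP fun x : Vec a => x i :=
  IsMLP.id.scalar i

theorem IsScalarMLP.const (c : ℝ) : IsScalarMLP fun _ : Vec a => c := by
  unfold IsScalarMLP
  convert IsMLP.affine (0 : Matrix (Fin 1) (Fin a) ℝ) (fun _ => c) using 2
  simp

theorem IsScalarMLP.add {f g : Vec a → ℝ} (hf : IsScalarMLP f) (hg : IsScalarMLP g) :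
    IsScalarMLP fun x => f x + g x := by
  unfold IsScalarMLP
  convert (IsMLP.append hf hg).linear (Matrix.of fun (_ : Fin 1) _ => 1) 0 using 2 with x
  ext i
  simp [mulVec, dotProduct, Fin.append, Fin.addCases]

theorem IsScalarMLP.const_mul {f : Vec a → ℝ} (hf : IsScalarMLP f) (c : ℝ) :
    IsScalarMLP fun x => c * f x := by
  unfold IsScalarMLP
  convert IsMLP.linear hf (Matrix.of fun (_ : Fin 1) _ => c) 0 using 2 with x
  ext i
  simp [mulVec, dotProduct]

theorem IsScalarMLP.sub {f g : Vec a → ℝ} (hf : IsScalarMLP f) (hg : IsScalarMLP g) :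
    IsScalarMLP fun x => f x - g x := by
  convert hf.add (hg.const_mul (-1)) using 2
  ring

theorem IsScalarMLP.posPart {f : Vec a → ℝ} (hf : IsScalarMLP f) :
    IsScalarMLP fun x => max (f x) 0 :=
  IsMLP.relu hf

theorem IsScalarMLP.sum {ι : Type*} (s : Finset ι) {f : ι → Vec a → ℝ}
    (hf : ∀ i, IsScalarMLP (f i)) : IsScalarMLP fun x => ∑ i ∈ s, f i x := by
  classical
  induction s using Finset.induction_on with
  | empty => simpa using IsScalarMLP.const 0
  | insert i s hi ih =>
    simp only [Finset.sum_insert hi]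
    exact (hf i).add ih

theorem IsScalarMLP.abs {f : Vec a → ℝ} (hf : IsScalarMLP f) :
    IsScalarMLP fun x => |f x| := by
  convert hf.posPart.add (hf.const_mul (-1)).posPart using 2 with x
  rcases le_total (f x) 0 with h | h
  · rw [abs_of_nonpos h, max_eq_right h, max_eq_left (by linarith)]; ring
  · rw [abs_of_nonneg h, max_eq_left h, max_eq_right (by linarith)]; ring

/-- Some MLP restricts to the indicator function of a point on a given finite set. -/
theorem exists_isScalarMLP_indicator (S : Finset (Vec a)) (s : Vec a) :
    ∃ f : Vec a → ℝ, IsScalarMLP f ∧ f s = 1 ∧ ∀ x ∈ S, x ≠ s → f x = 0 := by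
  have key : ∀ T : Finset (Vec a), ∃ C : ℝ, ∀ x ∈ T, x ≠ s → 1 ≤ C * ∑ i, |x i - s i| := by
    intro T
    -- The sum of all reciprocal distances to `s` dominates each of them; `s` itself would
    -- contribute `0⁻¹ = 0`.
    refine ⟨∑ x ∈ T, (∑ i, |x i - s i|)⁻¹, fun x hx hxs => ?_⟩
    have hpos : 0 < ∑ i, |x i - s i| := by
      obtain ⟨i, hi⟩ := Function.ne_iff.1 hxs
      exact Finset.sum_pos' (fun _ _ => abs_nonneg _)
        ⟨i, Finset.mem_univ i, abs_pos.2 (sub_ne_zero.2 hi)⟩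
    rw [← inv_mul_cancel₀ hpos.ne']
    refine mul_le_mul_of_nonneg_right ?_ hpos.le
    exact Finset.single_le_sum (f := fun x : Vec a => (∑ i, |x i - s i|)⁻¹)
      (fun y _ => inv_nonneg.2 (Finset.sum_nonneg fun _ _ => abs_nonneg _)) hx
  obtain ⟨C, hC⟩ := key S
  -- A spike at `s`, steep enough to vanish at all other points of `S`.
  refine ⟨fun x => max (1 - C * ∑ i, |x i - s i|) 0, ?_, by simp, fun x hx hxs => ?_⟩
  · exact ((IsScalarMLP.const 1).sub ((IsScalarMLP.sum _ fun i =>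
      ((IsScalarMLP.coord i).sub (IsScalarMLP.const _)).abs).const_mul C)).posPart
  · exact max_eq_right (by linarith [hC x hx hxs])

end MLP

/-! ### Standard MPNNs as MPNNs with Bloom signatures -/

section Embedding

/-- A message passing layer as a layer that ignores the edge features. -/
def MPLayer.toBloom {d d' : ℕ} (e : ℕ) (l : MPLayer d d') : BloomLayer e d d' where
  m := l.m
  -- The two models order the arguments of a message differently, so the blocks of `h_w` and `h_v`
  -- are swapped.
  phi x := l.phi (Fin.append (fun i => x (Fin.castAdd e (Fin.natAdd d i)))
    fun i => x (Fin.castAdd e (Fin.castAdd d i)))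
  agg := l.agg
  upd := l.upd

def MPStack.toBloom {F : ℕ} (e : ℕ) : {d : ℕ} → MPStack F d → BloomStack e F d
  | _, .input => .input
  | _, .layer prev l => .layer (prev.toBloom e) (l.toBloom e)

theorem MPStack.isNeural_toBloom {F d : ℕ} (e : ℕ) {s : MPStack F d} (hs : s.IsNeural) :
    (s.toBloom e).IsNeural := by
  induction s with
  | input => trivial
  | layer prev l ih =>
    refine ⟨ih hs.1, ?_, hs.2.2⟩
    exact hs.2.1.comp ((IsMLP.id.coords _).append (IsMLP.id.coords _))

theorem MPStack.eval_toBloom {F d e : ℕ} (s : MPStack F d) {V : Type} [Fintype V] (loops : Bool)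
    (G : SimpleGraph V) (E : V → V → Vec e) (X : V → Vec F) (v : V) :
    (s.toBloom e).eval loops G E X v = s.eval loops G X v := by
  induction s generalizing v with
  | input => rfl
  | layer prev l ih =>
    simp only [MPStack.toBloom, BloomStack.eval, MPStack.eval, MPLayer.toBloom, ih,
      Fin.append_left, Fin.append_right]

/-- A standard MPNN as an MPNN with Bloom signatures that ignores the signatures. -/
def MPNN.toBloom {F : ℕ} (n : ℕ) (M : MPNN F) : BloomNet n F 1 where
  e := 0
  psi _ := 0
  d := M.d
  layers := M.layers.toBloom 0
  k := M.k
  dec := M.dec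
  p := 0
  sHat _ := 0
  head x := M.head fun i => x (Fin.castAdd 0 i)

theorem MPNN.isNeural_toBloom {F : ℕ} (n : ℕ) {M : MPNN F} (hM : M.IsNeural) :
    (M.toBloom n).IsNeural :=
  ⟨IsMLP.pi fun i => i.elim0, MPStack.isNeural_toBloom 0 hM.1, hM.2.1, IsMLP.pi fun i => i.elim0,
    hM.2.2.comp (IsMLP.id.coords _)⟩

theorem MPNN.score_toBloom {F n : ℕ} (M : MPNN F) {V : Type} [Fintype V] (loops : Bool)
    (G : SimpleGraph V) (X : V → Vec F) (H : V → Fin n) (u v : V) :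
    (M.toBloom n).score loops G X H u v = M.score loops G X u v := by
  simp only [BloomNet.score, BloomNet.pair, BloomNet.node, MPNN.score, MPNN.toBloom,
    MPStack.eval_toBloom, Fin.append_left]

end Embedding

/-! ### Simulating 1-WL by sum aggregation -/

section ColourRefinement

theorem mem_nbhd {V : Type} [Fintype V] {loops : Bool} {G : SimpleGraph V} {v w : V} :
    w ∈ nbhd loops G v ↔ G.Adj v w ∨ (loops = true ∧ w = v) := by
  simp [nbhd]

open Classical in
/-- The neighbourhood with loops arises from the one without by adding the node. -/
theorem map_nbhd_val {V : Type} [Fintype V] (loops : Bool) (G : SimpleGraph V) (v : V)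
    {α : Type*} (f : V → α) :
    (nbhd loops G v).val.map f = (if loops = true then {f v} else 0) +
      (Finset.univ.filter fun w => G.Adj v w).val.map f := by
  cases loops with
  | false => simp [nbhd]
  | true =>
    have h : nbhd true G v =
        Finset.cons v (Finset.univ.filter fun w => G.Adj v w) (by simp) := by
      ext w
      simp [mem_nbhd, or_comm]
    simp [h]

/-- The layer that appends to each state `h_v` the sums of `f j` over the states of the neighbours:
their numbers of occurrences among these states if the `f j` are indicator functions. -/
def countLayer (e : ℕ) {d N : ℕ} (f : Fin N → Vec d → ℝ) : BloomLayer e d (d + N) where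
  m := N
  phi x j := f j fun i => x (Fin.castAdd e (Fin.castAdd d i))
  agg s := s.sum
  upd x := x

theorem isNeural_countLayer (e : ℕ) {d N : ℕ} {f : Fin N → Vec d → ℝ}
    (hf : ∀ j, IsScalarMLP (f j)) : (countLayer e f).IsNeural :=
  ⟨IsMLP.pi fun j => (IsMLP.comp (hf j) (IsMLP.id.coords _)).scalar 0, IsAggregator.sum,
    IsMLP.id⟩

theorem sum_map_eq_count {α : Type*} [DecidableEq α] (s : Multiset α) (x : α) (f : α → ℝ)
    (h1 : f x = 1) (h0 : ∀ y ∈ s, y ≠ x → f y = 0) : (s.map f).sum = s.count x := by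
  induction s using Multiset.induction_on with
  | empty => simp
  | cons y s ih =>
    rw [Multiset.map_cons, Multiset.sum_cons, ih fun z hz => h0 z (Multiset.mem_cons_of_mem hz)]
    by_cases h : y = x
    · subst h; simp [h1, add_comm]
    · rw [h0 y (Multiset.mem_cons_self _ _) h, Multiset.count_cons_of_ne (Ne.symm h), zero_add]

theorem multiset_sum_apply {m : ℕ} (s : Multiset (Vec m)) (j : Fin m) :
    s.sum j = (s.map fun x => x j).sum :=
  map_multiset_sum (Pi.evalAddMonoidHom (fun _ => ℝ) j) s

/-- Used to rebuild the multiset of neighbour states from the counts that the network computes. -/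
theorem sum_count_nsmul_singleton {α ι : Type*} [DecidableEq α] [Fintype ι] {σ : ι → α}
    (hσ : σ.Injective) (s : Multiset α) (hs : ∀ y ∈ s, ∃ i, σ i = y) :
    ∑ i, s.count (σ i) • ({σ i} : Multiset α) = s := by
  classical
  ext y
  simp only [Multiset.count_sum', Multiset.count_nsmul, Multiset.count_singleton, mul_ite, mul_one,
    mul_zero]
  by_cases hy : ∃ i, σ i = y
  · obtain ⟨i, rfl⟩ := hy
    simp [hσ.eq_iff]
  · rw [Multiset.count_eq_zero_of_notMem fun h => hy (hs y h)]
    exact Finset.sum_eq_zero fun i _ => if_neg fun h => hy ⟨i, h.symm⟩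

section

variable {V : Type} [Fintype V] {d e F N : ℕ}

theorem eval_countLayer {loops : Bool} {G : SimpleGraph V} {E : V → V → Vec e} {X : V → Vec F}
    {s : BloomStack e F d} {h : V → Vec d} (hs : s.eval loops G E X = h)
    (f : Fin N → Vec d → ℝ) :
    (s.layer (countLayer e f)).eval loops G E X = fun v =>
      Fin.append (h v) fun j => ((nbhd loops G v).val.map fun w => f j (h w)).sum := by
  funext v
  simp only [BloomStack.eval, countLayer, hs, Fin.append_left]
  congr 1
  funext j
  rw [multiset_sum_apply, Multiset.map_map]
  rfl

open Classical in
/-- The refined colour as a function of the state with appended counts. -/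
noncomputable def decodeColour (loops : Bool) (σ : Fin N → Vec d) {t : ℕ} (g : Vec d → WL1Color F t)
    (y : Vec (d + N)) : WL1Color F (t + 1) :=
  (g fun i => y (Fin.castAdd N i),
    (∑ j, ⌊y (Fin.natAdd d j)⌋₊ • ({σ j} : Multiset (Vec d))).map g -
      if loops = true then {g fun i => y (Fin.castAdd N i)} else 0)

/-- The appended sums of indicators are multiplicities, hence naturals that the floor returns
unchanged. They determine the multiset of states over `N(v)`, and `g` turns states into colours.
With loops, the node's own colour has to be removed, since 1-WL counts proper neighbours only. -/
theorem decodeColour_append {loops : Bool} {G : SimpleGraph V} {X : V → Vec F} {σ : Fin N → Vec d}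
    (hσ : σ.Injective) {f : Fin N → Vec d → ℝ} (h1 : ∀ j, f j (σ j) = 1)
    (h0 : ∀ i j, i ≠ j → f j (σ i) = 0) {h : V → Vec d} (hh : ∀ v, ∃ i, σ i = h v) {t : ℕ}
    {g : Vec d → WL1Color F t} (hg : ∀ v, g (h v) = wl1 G X t v) (v : V) :
    decodeColour loops σ g
      (Fin.append (h v) fun j => ((nbhd loops G v).val.map fun w => f j (h w)).sum) =
        wl1 G X (t + 1) v := by
  classical
  have hc : ∀ j, ((nbhd loops G v).val.map fun w => f j (h w)).sum =
      ((nbhd loops G v).val.map h).count (σ j) := by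
    intro j
    rw [← sum_map_eq_count _ (σ j) (f j) (h1 j), Multiset.map_map]
    · rfl
    · intro y hy hne
      obtain ⟨w, -, rfl⟩ := Multiset.mem_map.1 hy
      obtain ⟨i, hi⟩ := hh w
      rw [← hi] at hne ⊢
      exact h0 i j fun hij => hne (hij ▸ rfl)
  have hs : ∀ y ∈ (nbhd loops G v).val.map h, ∃ i, σ i = y := by
    intro y hy
    obtain ⟨w, -, rfl⟩ := Multiset.mem_map.1 hy
    exact hh w
  simp only [decodeColour, Fin.append_left, Fin.append_right, hc, Nat.floor_natCast, hg,
    sum_count_nsmul_singleton hσ _ hs, Multiset.map_map]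
  rw [map_nbhd_val]
  simp only [Function.comp_apply, hg, wl1]
  exact Prod.ext rfl (add_tsub_cancel_left _ _)

end

variable {V V' : Type} [Fintype V] [Fintype V']

/-- Sum aggregation with MLPs simulates any number of rounds of colour refinement on two given
graphs: some function maps the states of the nodes to their colours. -/
theorem exists_stack_refines_wl1 (loops : Bool) (e : ℕ) {F : ℕ} (G : SimpleGraph V)
    (G' : SimpleGraph V') (X : V → Vec F) (X' : V' → Vec F) (t : ℕ) :
    ∃ (d : ℕ) (s : BloomStack e F d) (h : V → Vec d) (h' : V' → Vec d), s.IsNeural ∧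
      (∀ E, s.eval loops G E X = h) ∧ (∀ E, s.eval loops G' E X' = h') ∧
      ∃ g : Vec d → WL1Color F t, (∀ v, g (h v) = wl1 G X t v) ∧
        ∀ v, g (h' v) = wl1 G' X' t v := by
  classical
  induction t with
  | zero => exact ⟨F, .input, X, X', trivial, fun _ => rfl, fun _ => rfl, _root_.id, fun _ => rfl,
      fun _ => rfl⟩
  | succ t ih =>
    obtain ⟨d, s, h, h', hs, hE, hE', g, hg, hg'⟩ := ih
    -- A common list of states for both graphs, so that one layer serves both and its counts have
    -- the same meaning in each.
    set S : Finset (Vec d) := Finset.univ.image h ∪ Finset.univ.image h' with hS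
    choose f hf h1 h0 using exists_isScalarMLP_indicator S
    set σ : Fin S.card → Vec d := fun j => (S.equivFin.symm j).1 with hσ
    have hinj : σ.Injective := Subtype.val_injective.comp S.equivFin.symm.injective
    have hsurj : ∀ y ∈ S, ∃ i, σ i = y := fun y hy => ⟨S.equivFin ⟨y, hy⟩, by simp [hσ]⟩
    have hz : ∀ i j, i ≠ j → f (σ j) (σ i) = 0 := fun i j hij =>
      h0 _ _ (S.equivFin.symm i).2 (hinj.ne hij)
    refine ⟨_, s.layer (countLayer e fun j => f (σ j)), _, _,
      ⟨hs, isNeural_countLayer e fun j => hf _⟩, fun E => eval_countLayer (hE E) _,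
      fun E => eval_countLayer (hE' E) _, decodeColour loops σ g,
      decodeColour_append hinj (fun j => h1 _) hz (fun v => hsurj _ ?_) hg,
      decodeColour_append hinj (fun j => h1 _) hz (fun v => hsurj _ ?_) hg'⟩ <;>
    simp [hS]

/-- Different colours force different states, so the concatenated states of the two pairs differ in
some coordinate `i`. The head outputs that coordinate, and the sigmoid is injective. -/
theorem exists_bloomNet_separates (loops : Bool) (n : ℕ) {F : ℕ} {G : SimpleGraph V}
    {G' : SimpleGraph V'} {X : V → Vec F} {X' : V' → Vec F} {e : V × V} {e' : V' × V'}
    (h : WL1Separates G X e G' X' e') :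
    ∃ B : BloomNet n F 1, B.IsNeural ∧ ∀ (H : V → Fin n) (H' : V' → Fin n),
      B.score loops G X H e.1 e.2 ≠ B.score loops G' X' H' e'.1 e'.2 := by
  obtain ⟨t, ht⟩ := h
  obtain ⟨d, s, h, h', hs, hE, hE', g, hg, hg'⟩ := exists_stack_refines_wl1 loops 0 G G' X X' t
  have hne : Fin.append (h e.1) (h e.2) ≠ Fin.append (h' e'.1) (h' e'.2) := by
    intro heq
    refine ht (Prod.ext ?_ ?_)
    · have : h e.1 = h' e'.1 := by
        funext i
        simpa using congrFun heq (Fin.castAdd d i)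
      simp only [← hg, ← hg', this]
    · have : h e.2 = h' e'.2 := by
        funext i
        simpa [-Fin.natAdd_eq_addNat] using congrFun heq (Fin.natAdd d i)
      simp only [← hg, ← hg', this]
  obtain ⟨i, hi⟩ := Function.ne_iff.1 hne
  refine ⟨⟨0, fun _ => 0, d, s, d + d, fun x y => Fin.append x y, 0, fun _ => 0,
    fun x _ => x (Fin.castAdd 0 i)⟩, ⟨IsMLP.pi fun i => i.elim0, hs, IsDecoder.concat,
    IsMLP.pi fun i => i.elim0, IsMLP.id.coords _⟩, fun H H' heq => hi ?_⟩
  have := Real.sigmoid_injective heq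
  simpa only [BloomNet.pair, BloomNet.node, hE, hE', Fin.append_left] using this

end ColourRefinement

/-! ### Computable adjacency relations -/

section Adjacency

/-- Boolean adjacency of the cubic graph. -/
def cubicAdj (a b : Fin 8) : Bool :=
  (a, b) ∈ ([(0, 1), (0, 6), (0, 7), (1, 2), (1, 3), (2, 3), (2, 5),
    (3, 4), (4, 5), (4, 7), (5, 6), (6, 7)] : List (Fin 8 × Fin 8)) ∨
  (b, a) ∈ ([(0, 1), (0, 6), (0, 7), (1, 2), (1, 3), (2, 3), (2, 5),
    (3, 4), (4, 5), (4, 7), (5, 6), (6, 7)] : List (Fin 8 × Fin 8))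

theorem cubicGraph_adj {a b : Fin 8} : cubicGraph.Adj a b ↔ cubicAdj a b = true := by
  have : ∀ a b : Fin 8, cubicAdj a b = true → a ≠ b := by decide
  simp only [cubicGraph, SimpleGraph.fromRel_adj]
  refine ⟨fun h => decide_eq_true h.2, fun h => ⟨this a b h, of_decide_eq_true h⟩⟩

/-- Boolean adjacency of the Shrikhande graph, by coordinates. -/
def shrikhandeAdj (a b : Fin 4 × Fin 4) : Bool :=
  -- Bit `4 * i + j` of the mask says whether `(i, j)` is in the connection set; the set bits 1, 3,
  -- 4, 5, 12, 15 are `±(0,1)`, `±(1,0)`, `±(1,1)`.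
  Nat.testBit 0x903a (4 * ((b.1.val + 4 - a.1.val) % 4) + (b.2.val + 4 - a.2.val) % 4)

theorem shrikhande_adj {a b : ZMod 4 × ZMod 4} :
    shrikhande.Adj a b ↔ shrikhandeAdj a b = true := by
  -- `ZMod 4` unfolds to `Fin 4`, so the check over `Fin 4` applies to the original statement
  -- definitionally.
  have : ∀ a b : Fin 4 × Fin 4,
      (a ≠ b ∧ (b - a ∈ ([(1, 0), (0, 1), (1, 1)] : List (Fin 4 × Fin 4)) ∨
        a - b ∈ ([(1, 0), (0, 1), (1, 1)] : List (Fin 4 × Fin 4)))) ↔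
      shrikhandeAdj a b = true := by decide +kernel
  simp only [shrikhande, SimpleGraph.fromRel_adj]
  exact this a b

/-- Boolean adjacency of the Rook's graph. -/
def rookAdj (a b : Fin 4 × Fin 4) : Bool :=
  (a.1.val.beq b.1.val).xor (a.2.val.beq b.2.val)

theorem rook_adj {a b : Fin 4 × Fin 4} : rook.Adj a b ↔ rookAdj a b = true := by
  have : ∀ a b : Fin 4 × Fin 4,
      (a ≠ b ∧ ((a.1 = b.1 ∨ a.2 = b.2) ∨ (b.1 = a.1 ∨ b.2 = a.2))) ↔
      rookAdj a b = true := by decide +kernel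
  simp only [rook, SimpleGraph.fromRel_adj]
  exact this a b

end Adjacency

/-! ### The cubic graph: symmetry, and failure of 1-WL and standard MPNNs -/

section CubicGraph

theorem ncard_neighborSet_cubicGraph (v : Fin 8) : (cubicGraph.neighborSet v).ncard = 3 := by
  have h : cubicGraph.neighborSet v = (Finset.univ.filter fun w => cubicAdj v w = true) := by
    ext w
    simp [cubicGraph_adj]
  rw [h, Set.ncard_coe_finset]
  clear h
  revert v
  decide

theorem autNodes_cubicGraph : AutNodes cubicGraph 3 6 := by
  -- The graph is the 8-cycle `0, 1, …, 7` with chords `06`, `13`, `25`, `47`; this is the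
  -- reflection `i ↦ 1 - i` modulo 8, which permutes the chords.
  let f : Fin 8 → Fin 8 := ![1, 0, 7, 6, 5, 4, 3, 2]
  have hf : ∀ v, f (f v) = v := by decide
  have hadj : ∀ a b, cubicAdj (f a) (f b) = cubicAdj a b := by decide
  exact ⟨⟨⟨f, f, hf, hf⟩, by simp [cubicGraph_adj, hadj]⟩, rfl⟩

/-- Automorphisms preserve adjacency, and `0` is adjacent to `6` but not to `3`. -/
theorem not_autPairs_cubicGraph : ¬ AutPairs cubicGraph (0, 3) (0, 6) := by
  rintro ⟨π, h0, h3⟩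
  have h : cubicGraph.Adj (π 0) (π 3) ↔ cubicGraph.Adj 0 3 := π.map_rel_iff
  rw [show π 0 = 0 from h0, show π 3 = 6 from h3, cubicGraph_adj, cubicGraph_adj] at h
  revert h
  decide

open Classical in
theorem card_filter_adj_cubicGraph (v : Fin 8) :
    (Finset.univ.filter fun w => cubicGraph.Adj v w).card = 3 := by
  rw [← ncard_neighborSet_cubicGraph v, ← Set.ncard_coe_finset]
  congr 1
  ext w
  simp

theorem wl1_cubicGraph_const {F : ℕ} (x : Vec F) (t : ℕ) (u v : Fin 8) :
    wl1 cubicGraph (fun _ => x) t u = wl1 cubicGraph (fun _ => x) t v := by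
  classical
  induction t generalizing u v with
  | zero => rfl
  | succ t ih =>
    refine Prod.ext (ih u v) ?_
    simp only [wl1, ih _ 0, Multiset.map_const', Finset.card_val]
    exact congrArg (Multiset.replicate · _)
      ((card_filter_adj_cubicGraph u).trans (card_filter_adj_cubicGraph v).symm)

theorem card_nbhd_cubicGraph (loops : Bool) (u v : Fin 8) :
    (nbhd loops cubicGraph u).card = (nbhd loops cubicGraph v).card := by
  classical
  have h : ∀ w, (nbhd loops cubicGraph w).card = (if loops = true then 1 else 0) + 3 := by
    intro w
    have := congrArg Multiset.card (map_nbhd_val loops cubicGraph w fun _ => ())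
    rw [Multiset.card_map, Multiset.card_add, Multiset.card_map, Finset.card_val, Finset.card_val]
      at this
    rw [this]
    congr 1
    · split <;> rfl
    · convert card_filter_adj_cubicGraph w
  rw [h, h]

theorem eval_cubicGraph_const {F d : ℕ} (s : MPStack F d) (loops : Bool) (x : Vec F)
    (u v : Fin 8) : s.eval loops cubicGraph (fun _ => x) u =
      s.eval loops cubicGraph (fun _ => x) v := by
  induction s generalizing u v with
  | input => rfl
  | layer prev l ih =>
    simp only [MPStack.eval, ih _ 0, Multiset.map_const', Finset.card_val,
      card_nbhd_cubicGraph loops u v]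

end CubicGraph

/-! ### The Shrikhande and Rook's graphs are not isomorphic -/

section Isomorphism

/-- A row of the Rook's graph is a 4-clique, whereas the Shrikhande graph has none (`hK`). -/
theorem isEmpty_shrikhande_iso_rook : IsEmpty (shrikhande ≃g rook) := by
  refine ⟨fun π => ?_⟩
  have hK : ∀ a b : Fin 4 × Fin 4, shrikhandeAdj a b = true → ∀ c, shrikhandeAdj a c = true →
      shrikhandeAdj b c = true → ∀ d, shrikhandeAdj a d = true → shrikhandeAdj b d = true →
      shrikhandeAdj c d = false := by decide +kernel
  have hadj : ∀ a b : Fin 4 × Fin 4, rookAdj a b = true →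
      shrikhandeAdj (π.symm a) (π.symm b) = true := fun a b h =>
    shrikhande_adj.1 (π.symm.map_rel_iff.2 (rook_adj.2 h))
  have h := hK (π.symm (0, 0)) (π.symm (0, 1)) (hadj _ _ rfl) (π.symm (0, 2)) (hadj _ _ rfl)
    (hadj _ _ rfl) (π.symm (0, 3)) (hadj _ _ rfl) (hadj _ _ rfl)
  rw [hadj _ _ rfl] at h
  cases h

end Isomorphism

/-! ### 3-WL on strongly regular graphs with equal parameters -/

section WeisfeilerLeman

variable {V V' : Type}

/-- The relation of two nodes: whether they are equal and whether they are adjacent. -/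
def pairType (G : SimpleGraph V) (a b : V) : Prop × Prop := (a = b, G.Adj a b)

theorem pairType_comm (G : SimpleGraph V) (a b : V) : pairType G a b = pairType G b a := by
  simp only [pairType, eq_comm, G.adj_comm]

/-- Node pairs of equal type see the nodes in the same way. This holds for strongly regular graphs
with equal parameters. -/
def PairExtension (G : SimpleGraph V) (G' : SimpleGraph V') : Prop :=
  ∀ p q p' q', pairType G p q = pairType G' p' q' → ∃ e : V ≃ V', ∀ w,
    pairType G w p = pairType G' (e w) p' ∧ pairType G w q = pairType G' (e w) q'

variable {G : SimpleGraph V} {G' : SimpleGraph V'}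

/-- When one entry of a triple is replaced, only the relations to the other two matter, and these
form a pair. This is where the dimension 3 is used. -/
theorem PairExtension.triple (h : PairExtension G G') {a : Fin 3 → V} {b : Fin 3 → V'}
    (hab : ∀ i j, pairType G (a i) (a j) = pairType G' (b i) (b j)) (i : Fin 3) :
    ∃ e : V ≃ V', ∀ w j, j ≠ i → pairType G w (a j) = pairType G' (e w) (b j) := by
  have key : ∀ j k : Fin 3, (∀ l, l ≠ i → l = j ∨ l = k) → ∃ e : V ≃ V', ∀ w l, l ≠ i →
      pairType G w (a l) = pairType G' (e w) (b l) := by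
    intro j k hjk
    obtain ⟨e, he⟩ := h _ _ _ _ (hab j k)
    refine ⟨e, fun w l hl => ?_⟩
    rcases hjk l hl with rfl | rfl
    · exact (he w).1
    · exact (he w).2
  -- Modulo 3, these are the two positions other than `i`.
  exact key (i + 1) (i + 2) (by clear key hab; revert i; decide)

/-- The type of a node pair as an element of `Fin 3`. -/
def pairCode [DecidableEq V] (r : V → V → Bool) (a b : V) : Fin 3 :=
  if a = b then 0 else if r a b then 1 else 2

theorem pairCode_eq_iff [DecidableEq V] [DecidableEq V'] {r : V → V → Bool} {r' : V' → V' → Bool}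
    (hr : ∀ a b, G.Adj a b ↔ r a b = true) (hr' : ∀ a b, G'.Adj a b ↔ r' a b = true) {a b : V}
    {a' b' : V'} :
    pairCode r a b = pairCode r' a' b' ↔ pairType G a b = pairType G' a' b' := by
  have h1 : r a b = true → a ≠ b := fun h => ((hr a b).2 h).ne
  have h2 : r' a' b' = true → a' ≠ b' := fun h => ((hr' a' b').2 h).ne
  simp only [pairCode, pairType, Prod.mk.injEq, eq_iff_iff, hr, hr']
  by_cases h : a = b <;> by_cases h' : a' = b' <;> cases hra : r a b <;> cases hra' : r' a' b' <;>
    simp_all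

variable [Fintype V] [Fintype V']

theorem map_univ_val_congr {α : Type*} (e : V ≃ V') {f : V → α} {g : V' → α}
    (h : ∀ w, f w = g (e w)) :
    (Finset.univ : Finset V).val.map f = (Finset.univ : Finset V').val.map g := by
  rw [← Multiset.map_univ_val_equiv e, Multiset.map_map]
  exact Multiset.map_congr rfl fun w _ => h w

/-- Isomorphism types of triples are already stable: `PairExtension.triple` matches the replacements
`w` with the replacements `e w` so that types agree again, and induction gives equal multisets of
colours. -/
theorem PairExtension.wl_eq (h : PairExtension G G') (t : ℕ) {a : Fin 3 → V} {b : Fin 3 → V'}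
    (hab : ∀ i j, pairType G (a i) (a j) = pairType G' (b i) (b j)) :
    wl 3 G t a = wl 3 G' t b := by
  induction t generalizing a b with
  | zero => exact funext fun i => funext fun j => hab i j
  | succ t ih =>
    refine Prod.ext (ih hab) (funext fun i => ?_)
    obtain ⟨e, he⟩ := h.triple hab i
    refine map_univ_val_congr e fun w => ih fun j k => ?_
    by_cases hj : j = i <;> by_cases hk : k = i
    · subst hj; subst hk; simp [pairType]
    · subst hj; simpa [hk] using he w k hk
    · subst hk
      rw [pairType_comm G, pairType_comm G']
      simpa [hj] using he w j hj
    · simpa [hj, hk] using hab j k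

/-- Triples as functions. -/
def tripleEquiv (V : Type) : V × V × V ≃ (Fin 3 → V) where
  toFun x := ![x.1, x.2.1, x.2.2]
  invFun a := (a 0, a 1, a 2)
  left_inv _ := rfl
  right_inv a := by
    funext i
    fin_cases i <;> rfl

/-- By `PairExtension.wl_eq` a type-preserving bijection of triples suffices. It is built entry by
entry, each bijection depending on the entries already mapped. -/
theorem PairExtension.wlEquiv (h : PairExtension G G') (e : V ≃ V') : WLEquiv 3 G G' := by
  intro t
  have hrefl : ∀ p, pairType G p p = pairType G' (e p) (e p) := fun p => by simp [pairType]
  -- The degenerate pair `(p, p)` gives a bijection for the second entry that respects its relation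
  -- to the first.
  choose e₁ h₁ using fun p => h p p _ _ (hrefl p)
  have hpq : ∀ p q, pairType G p q = pairType G' (e p) (e₁ p q) := fun p q => by
    rw [pairType_comm G, pairType_comm G']
    exact (h₁ p q).1
  choose e₂ h₂ using fun p q => h p q _ _ (hpq p q)
  let E : (Fin 3 → V) ≃ (Fin 3 → V') := (tripleEquiv V).symm.trans
    ((Equiv.prodShear e fun p => Equiv.prodShear (e₁ p) fun q => e₂ p q).trans (tripleEquiv V'))
  refine map_univ_val_congr E fun a => h.wl_eq t ?_
  have h01 : pairType G (a 0) (a 1) = pairType G' (E a 0) (E a 1) := hpq _ _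
  have h20 : pairType G (a 2) (a 0) = pairType G' (E a 2) (E a 0) := (h₂ _ _ _).1
  have h21 : pairType G (a 2) (a 1) = pairType G' (E a 2) (E a 1) := (h₂ _ _ _).2
  have hr : ∀ i, pairType G (a i) (a i) = pairType G' (E a i) (E a i) := fun i => by
    simp [pairType]
  have hs : ∀ i j, pairType G (a i) (a j) = pairType G' (E a i) (E a j) →
      pairType G (a j) (a i) = pairType G' (E a j) (E a i) := fun i j hij => by
    rwa [pairType_comm G, pairType_comm G']
  intro i j
  fin_cases i <;> fin_cases j
  exacts [hr 0, h01, hs _ _ h20, hs _ _ h01, hr 1, hs _ _ h21, h20, h21, hr 2]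

/-- The number of nodes in given relations to two nodes, for strongly regular graphs with parameters
`(16, 6, 2, 2)`. -/
def srgCount : Fin 3 → Fin 3 → Fin 3 → ℕ :=
  ![![![1, 0, 0], ![0, 6, 0], ![0, 0, 9]],
    ![![0, 1, 0], ![1, 2, 3], ![0, 3, 6]],
    ![![0, 0, 1], ![0, 2, 4], ![1, 4, 4]]]

/-- Classify `w` by its relations to `p` and `q`. Corresponding classes in the two graphs have equal
size because both are given by the same table `T`, and bijections between them glue. -/
theorem pairExtension_of_count [DecidableEq V] [DecidableEq V'] {r : V → V → Bool}
    {r' : V' → V' → Bool} (hr : ∀ a b, G.Adj a b ↔ r a b = true)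
    (hr' : ∀ a b, G'.Adj a b ↔ r' a b = true) {T : Fin 3 → Fin 3 → Fin 3 → ℕ}
    (hT : ∀ p q x y, (Finset.univ.filter fun w => pairCode r w p = x ∧ pairCode r w q = y).card =
      T (pairCode r p q) x y)
    (hT' : ∀ p q x y,
      (Finset.univ.filter fun w => pairCode r' w p = x ∧ pairCode r' w q = y).card =
        T (pairCode r' p q) x y) : PairExtension G G' := by
  intro p q p' q' hpq
  have hcard : ∀ c : Fin 3 × Fin 3,
      Nonempty ({w // (pairCode r w p, pairCode r w q) = c} ≃
        {w // (pairCode r' w p', pairCode r' w q') = c}) := by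
    rintro ⟨x, y⟩
    refine ⟨Fintype.equivOfCardEq ?_⟩
    rw [Fintype.card_subtype, Fintype.card_subtype]
    simp only [Prod.mk.injEq]
    rw [hT, hT', (pairCode_eq_iff hr hr').2 hpq]
  refine ⟨Equiv.ofFiberEquiv fun c => (hcard c).some, fun w => ?_⟩
  have h := Equiv.ofFiberEquiv_map (fun c => (hcard c).some) w
  rw [Prod.mk.injEq] at h
  exact ⟨(pairCode_eq_iff hr hr').1 h.1.symm, (pairCode_eq_iff hr hr').1 h.2.symm⟩

theorem pairCount_shrikhande : ∀ (p q : Fin 4 × Fin 4) (x y : Fin 3),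
    (Finset.univ.filter fun w =>
      pairCode shrikhandeAdj w p = x ∧ pairCode shrikhandeAdj w q = y).card =
        srgCount (pairCode shrikhandeAdj p q) x y := by
  decide +kernel

theorem pairCount_rook : ∀ (p q : Fin 4 × Fin 4) (x y : Fin 3),
    (Finset.univ.filter fun w => pairCode rookAdj w p = x ∧ pairCode rookAdj w q = y).card =
        srgCount (pairCode rookAdj p q) x y := by
  decide +kernel

theorem wlEquiv_shrikhande_rook : WLEquiv 3 shrikhande rook :=
  PairExtension.wlEquiv (pairExtension_of_count (V := Fin 4 × Fin 4) (V' := Fin 4 × Fin 4)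
    (G := shrikhande) (G' := rook) (fun _ _ => shrikhande_adj) (fun _ _ => rook_adj)
    pairCount_shrikhande pairCount_rook) (Equiv.refl (Fin 4 × Fin 4))

end WeisfeilerLeman

/-! ### Networks that read collision-free signatures -/

section SignatureNetwork

/-- The network with one message passing layer with messages `g (s_w || s_v)` and sum aggregation,
whose head sees the two node states and the two Bloom signatures. -/
def signatureNet {n m r : ℕ} (F : ℕ) (g : Vec (n + n) → Vec m)
    (head : Vec (m + m + (n + n)) → Vec r) : BloomNet n F r where
  e := n + n
  psi x := x
  d := m
  layers := .layer .input
    { m := m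
      phi := fun x => g fun i => x (Fin.natAdd (F + F) i)
      agg := fun s => s.sum
      upd := fun x i => x (Fin.natAdd F i) }
  k := m + m
  dec x y := Fin.append x y
  p := n + n
  sHat x := x
  head := head

theorem isNeural_signatureNet {n m r : ℕ} (F : ℕ) {g : Vec (n + n) → Vec m}
    {head : Vec (m + m + (n + n)) → Vec r} (hg : IsMLP g) (hh : IsMLP head) :
    (signatureNet F g head).IsNeural :=
  ⟨IsMLP.id, ⟨trivial, hg.comp (IsMLP.id.coords _), IsAggregator.sum, IsMLP.id.coords _⟩,
    IsDecoder.concat, IsMLP.id, hh⟩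

variable {V : Type} [Fintype V]

theorem pair_signatureNet {n m r F : ℕ} (g : Vec (n + n) → Vec m)
    (head : Vec (m + m + (n + n)) → Vec r) (loops : Bool) (G : SimpleGraph V) (X : V → Vec F)
    (H : V → Fin n) (u v : V) :
    (signatureNet F g head).pair loops G X H u v =
      let s := bloomSig loops G H
      let h := fun v => ∑ w ∈ nbhd loops G v, g (Fin.append (s w) (s v))
      head (Fin.append (Fin.append (h u) (h v)) (Fin.append (s u) (s v))) := by
  simp only [signatureNet, BloomNet.pair, BloomNet.node, BloomStack.eval, Fin.append_right]
  rfl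

variable {loops : Bool} {G : SimpleGraph V} {R : V → V → Bool} {n : ℕ} {H : V → Fin n}

/-- Without collisions, the cell `H w` can only be filled by `w` itself. -/
theorem bloomSig_apply_hash (hR : ∀ v w, w ∈ nbhd loops G v ↔ R v w = true) (hH : H.Injective)
    (v w : V) : bloomSig loops G H v (H w) = ((R v w).toNat : ℝ) := by
  have h : (∃ x ∈ nbhd loops G v, H x = H w) ↔ R v w = true := by
    rw [← hR]
    exact ⟨fun ⟨x, hx, hxw⟩ => hH hxw ▸ hx, fun h => ⟨w, h, rfl⟩⟩
  simp only [bloomSig, h]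
  cases R v w <;> simp

theorem bloomSig_apply_of_notMem_range {j : Fin n} (hj : j ∉ Set.range H) (v : V) :
    bloomSig loops G H v j = 0 :=
  if_neg fun ⟨w, _, hw⟩ => hj ⟨w, hw⟩

theorem sum_nbhd_eq (hR : ∀ v w, w ∈ nbhd loops G v ↔ R v w = true) (v : V) (f : V → ℝ)
    (k : V → ℕ) (hk : ∀ w, f w = k w) :
    ∑ w ∈ nbhd loops G v, f w = ((∑ w, bif R v w then k w else 0 : ℕ) : ℝ) := by
  classical
  have h : nbhd loops G v = Finset.univ.filter fun w => R v w = true := by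
    ext w
    simp [hR]
  rw [h, Finset.sum_filter, Nat.cast_sum]
  refine Finset.sum_congr rfl fun w _ => ?_
  cases R v w <;> simp [hk]

/-- Truncated subtraction is a ReLU. Network outputs thus become expressions in natural numbers,
free of `H`, that can be evaluated by `decide`. -/
theorem natCast_tsub_eq_max (a b : ℕ) : ((a - b : ℕ) : ℝ) = max ((a : ℝ) - b) 0 := by
  rcases le_total a b with h | h
  · rw [Nat.sub_eq_zero_of_le h, Nat.cast_zero, max_eq_right]
    exact sub_nonpos.2 (Nat.cast_le.2 h)
  · rw [Nat.cast_sub h, max_eq_left]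
    exact sub_nonneg.2 (Nat.cast_le.2 h)

/-- The number of common neighbours. -/
def codegree (R : V → V → Bool) (v x : V) : ℕ := ∑ w, bif R v w then (R w x).toNat else 0

end SignatureNetwork

/-! ### Separating the pairs of the cubic graph -/

section CommonNeighbours

variable {n : ℕ}

/-- The head that identifies the first node by its codegree with itself, which exceeds `c`, and
tests whether it belongs to the neighbourhood of the second node. -/
def memHead (c : ℕ) (y : Vec (n + n + (n + n))) : Vec 1 := fun _ =>
  ∑ j, max (max (y (Fin.castAdd (n + n) (Fin.castAdd n j)) - c) 0 +
    y (Fin.natAdd (n + n) (Fin.natAdd n j)) - 1) 0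

theorem isMLP_memHead (c : ℕ) : IsMLP (memHead (n := n) c) :=
  IsMLP.pi fun _ => IsScalarMLP.sum _ fun _ =>
    ((((IsScalarMLP.coord _).sub (IsScalarMLP.const _)).posPart.add
      (IsScalarMLP.coord _)).sub (IsScalarMLP.const _)).posPart

/-- The network with messages `s_w` and the head `memHead c`. -/
def memNet (n F c : ℕ) : BloomNet n F 1 :=
  signatureNet F (fun z j => z (Fin.castAdd n j)) (memHead c)

theorem isNeural_memNet (n F c : ℕ) : (memNet n F c).IsNeural :=
  isNeural_signatureNet F (IsMLP.id.coords _) (isMLP_memHead c)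

variable {V : Type} [Fintype V] {loops : Bool} {G : SimpleGraph V} {R : V → V → Bool}
  {H : V → Fin n}

/-- The state of `u` at the cell of `x` is the codegree of `u` and `x`; empty cells contribute
nothing. If only `x = u` has codegree above `c`, and exceeds it by 1, the sum is the indicator of `u
∈ N(v)`. -/
theorem pair_memNet (hR : ∀ v w, w ∈ nbhd loops G v ↔ R v w = true) (hH : H.Injective) {F : ℕ}
    (X : V → Vec F) (c : ℕ) (u v : V) :
    (memNet n F c).pair loops G X H u v 0 =
      ((∑ x, (codegree R u x - c + (R v x).toNat - 1) : ℕ) : ℝ) := by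
  simp only [memNet, pair_signatureNet, memHead, Fin.append_left, Fin.append_right,
    Finset.sum_apply]
  rw [Nat.cast_sum]
  refine (Fintype.sum_of_injective H hH _ _ (fun j hj => ?_) fun x => ?_).symm
  · simp [bloomSig_apply_of_notMem_range hj]
  · rw [natCast_tsub_eq_max, Nat.cast_add, natCast_tsub_eq_max, bloomSig_apply_hash hR hH,
      sum_nbhd_eq hR u _ _ fun w => bloomSig_apply_hash hR hH w x, Nat.cast_one]
    rfl

theorem mem_nbhd_iff [DecidableEq V] (hR : ∀ a b, G.Adj a b ↔ R a b = true) (v w : V) :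
    w ∈ nbhd loops G v ↔ (R v w || (loops && decide (w = v))) = true := by
  simp [mem_nbhd, hR]

theorem exists_bloomNet_separates_cubicGraph (loops : Bool) (n F : ℕ) :
    ∃ B : BloomNet n F 1, B.IsNeural ∧
      ∀ (x : Vec F) (H H' : Fin 8 → Fin n), H.Injective → H'.Injective →
        B.score loops cubicGraph (fun _ => x) H 0 3 ≠
          B.score loops cubicGraph (fun _ => x) H' 0 6 := by
  have key : ∀ loops : Bool, ∃ c, ∀ R : Fin 8 → Fin 8 → Bool,
      (R = fun v w => cubicAdj v w || (loops && decide (w = v))) →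
      ∑ x, (codegree R 0 x - c + (R 3 x).toNat - 1) ≠
        ∑ x, (codegree R 0 x - c + (R 6 x).toNat - 1) := by
    rintro (_ | _)
    -- Node `0` has codegree 3 with itself and at most 1 with other nodes. With loops these numbers
    -- become 4 and at most 3, hence the threshold 3 in the other case.
    · refine ⟨2, ?_⟩
      rintro R rfl
      decide +kernel
    · refine ⟨3, ?_⟩
      rintro R rfl
      decide +kernel
  obtain ⟨c, hc⟩ := key loops
  refine ⟨memNet n F c, isNeural_memNet n F c, fun x H H' hH hH' heq => hc _ rfl ?_⟩
  have h := Real.sigmoid_injective heq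
  rw [pair_memNet (mem_nbhd_iff fun _ _ => cubicGraph_adj) hH,
    pair_memNet (mem_nbhd_iff fun _ _ => cubicGraph_adj) hH'] at h
  exact_mod_cast h

end CommonNeighbours

/-! ### Counting 4-cliques to separate the Shrikhande and Rook's graphs -/

section Cliques

variable {n : ℕ}

/-- Messages consisting of `s_w` and the indicators of the pairs `i, j` of common elements of `s_w`
and `s_v`. -/
def cliqueMessage (z : Vec (n + n)) : Vec (n + n * n) :=
  Fin.append (fun j => z (Fin.castAdd n j)) fun k =>
    max (z (Fin.castAdd n (finProdFinEquiv.symm k).1) +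
      z (Fin.castAdd n (finProdFinEquiv.symm k).2) + z (Fin.natAdd n (finProdFinEquiv.symm k).1) +
      z (Fin.natAdd n (finProdFinEquiv.symm k).2) - 3) 0

theorem isMLP_cliqueMessage : IsMLP (cliqueMessage (n := n)) := by
  refine IsMLP.append (IsMLP.id.coords _) (IsMLP.pi fun k => ?_)
  exact (((((IsScalarMLP.coord _).add (IsScalarMLP.coord _)).add (IsScalarMLP.coord _)).add
    (IsScalarMLP.coord _)).sub (IsScalarMLP.const _)).posPart

/-- The head that identifies the first node by its codegree with itself, which is `c + q`, and sums
the entries of the second node's state that belong to it and one of its neighbours. -/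
def cliqueHead (c q : ℕ) (y : Vec (n + n * n + (n + n * n) + (n + n))) : Vec 1 := fun _ =>
  -- A conjunction by large weights: on graphs with at most 100 nodes the entry in the middle is at
  -- most 100, so it survives the ReLU, unchanged, only if the excess codegree is the full `q` and
  -- the signature bit is 1.
  ∑ i, ∑ j, max (100 * max (y (Fin.castAdd (n + n) (Fin.castAdd (n + n * n)
      (Fin.castAdd (n * n) i))) - c) 0 +
    y (Fin.castAdd (n + n) (Fin.natAdd (n + n * n) (Fin.natAdd n (finProdFinEquiv (i, j))))) +
    100 * y (Fin.natAdd (n + n * n + (n + n * n)) (Fin.castAdd n j)) -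
    ((100 * q + 100 : ℕ) : ℝ)) 0

theorem isMLP_cliqueHead (c q : ℕ) : IsMLP (cliqueHead (n := n) c q) :=
  IsMLP.pi fun _ => IsScalarMLP.sum _ fun _ => IsScalarMLP.sum _ fun _ =>
    ((((((IsScalarMLP.coord _).sub (IsScalarMLP.const _)).posPart.const_mul _).add
      (IsScalarMLP.coord _)).add ((IsScalarMLP.coord _).const_mul _)).sub
        (IsScalarMLP.const _)).posPart

/-- The network with messages `cliqueMessage`, head `cliqueHead c q` and sum pooling. -/
def cliqueNet (n F c q : ℕ) : BloomGraphNet n F where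
  r := 1
  net := signatureNet F cliqueMessage (cliqueHead c q)
  pool s := s.sum
  readout x := x

theorem isNeural_cliqueNet (n F c q : ℕ) : (cliqueNet n F c q).IsNeural :=
  ⟨isNeural_signatureNet F isMLP_cliqueMessage (isMLP_cliqueHead c q), IsAggregator.sum, IsMLP.id⟩

variable {V : Type} [Fintype V] {loops : Bool} {G : SimpleGraph V} {R : V → V → Bool}
  {H : V → Fin n}

/-- The number of common neighbours of `v`, `x` and `y` if `x` and `y` are neighbours of `v`. -/
def cliqueCount (R : V → V → Bool) (v x y : V) : ℕ :=
  ∑ w, bif R v w then (R w x && (R w y && (R v x && R v y))).toNat else 0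

theorem cliqueCount_le_card (R : V → V → Bool) (v x y : V) :
    cliqueCount R v x y ≤ Fintype.card V := by
  refine (Finset.sum_le_card_nsmul _ _ 1 fun w _ => ?_).trans (by simp)
  cases R v w
  · simp
  · exact Bool.toNat_le _

/-- The double sum over cells reduces to one over nodes, since empty cells contribute 0; the rest is
the dictionary between ReLU and truncated subtraction. The bound `hc` is needed when only the second
cell is empty. -/
theorem pair_cliqueNet (hR : ∀ v w, w ∈ nbhd loops G v ↔ R v w = true) (hH : H.Injective) {F : ℕ}
    (X : V → Vec F) {c q : ℕ} (hc : ∀ u x, codegree R u x - c ≤ q) (u v : V) :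
    (signatureNet F cliqueMessage (cliqueHead c q)).pair loops G X H u v 0 =
      ((∑ x, ∑ y, (100 * (codegree R u x - c) + cliqueCount R v x y + 100 * (R u y).toNat -
        (100 * q + 100)) : ℕ) : ℝ) := by
  have hneg : ∀ t : ℝ, t ≤ 100 → max (t - ((100 * q + 100 : ℕ) : ℝ)) 0 = 0 := by
    intro t ht
    refine max_eq_right ?_
    push_cast
    have : (0 : ℝ) ≤ q := q.cast_nonneg
    linarith
  have hle : ∀ v j, bloomSig loops G H v j ≤ 1 := by
    intro v j
    unfold bloomSig
    split <;> norm_num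
  have hmax : ∀ a b : ℝ, a ≤ 1 → b ≤ 1 → max (a + b - 3) 0 = 0 := fun a b ha hb =>
    max_eq_right (by linarith)
  simp only [pair_signatureNet, cliqueHead, cliqueMessage, Fin.append_left, Fin.append_right,
    Finset.sum_apply, Equiv.symm_apply_apply]
  rw [Nat.cast_sum]
  refine (Fintype.sum_of_injective H hH _ _ (fun i hi => ?_) fun x => ?_).symm
  -- Cell `i` is empty: the codegree part and the pair count vanish, and the signature bit alone
  -- contributes at most 100.
  · refine Finset.sum_eq_zero fun j _ => ?_
    simp only [bloomSig_apply_of_notMem_range hi, Finset.sum_const_zero, zero_add, add_zero]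
    rw [Finset.sum_eq_zero fun w _ => hmax _ _ (hle _ _) (hle _ _),
      max_eq_right (sub_nonpos.2 (Nat.cast_nonneg c))]
    exact hneg _ (by linarith [hle u j])
  rw [Nat.cast_sum]
  refine Fintype.sum_of_injective H hH _ _ (fun j hj => ?_) fun y => ?_
  -- Cell `j` is empty: the pair count and the signature bit vanish, and the codegree part is at
  -- most `100 * q`.
  · simp only [bloomSig_apply_of_notMem_range hj, add_zero, mul_zero]
    rw [Finset.sum_eq_zero fun w _ => hmax _ _ (hle _ _) (hle _ _),
      sum_nbhd_eq hR u _ _ fun w => bloomSig_apply_hash hR hH w x]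
    have h : max ((codegree R u x : ℝ) - c) 0 ≤ q := by
      rw [← natCast_tsub_eq_max]
      exact_mod_cast hc u x
    refine max_eq_right ?_
    rw [codegree] at h
    push_cast at h ⊢
    linarith
  · rw [natCast_tsub_eq_max, Nat.cast_add, Nat.cast_add, Nat.cast_mul, Nat.cast_mul,
      natCast_tsub_eq_max, bloomSig_apply_hash hR hH u y, Nat.cast_ofNat,
      sum_nbhd_eq hR u _ _ fun w => bloomSig_apply_hash hR hH w x,
      sum_nbhd_eq hR v _ (fun w => (R w x && (R w y && (R v x && R v y))).toNat) fun w => ?_]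
    · rfl
    · simp only [bloomSig_apply_hash hR hH]
      cases R w x <;> cases R w y <;> cases R v x <;> cases R v y <;> norm_num

/-- The codegree singles out `x = u`. What remains counts the quadruples `u, v, y, w` that are
pairwise related by `R`: ordered 4-cliques, together with degenerate ones if there are loops. -/
theorem output_cliqueNet [DecidableEq V] (hR : ∀ v w, w ∈ nbhd loops G v ↔ R v w = true)
    (hH : H.Injective) {F : ℕ} (X : V → Vec F) {c q : ℕ} (hq : 0 < q)
    (hc : ∀ u x, codegree R u x - c = if u = x then q else 0) (hV : Fintype.card V ≤ 100) :
    (cliqueNet n F c q).output loops G X H =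
      ((∑ u, ∑ v, ∑ y, bif R u y then cliqueCount R v u y else 0 : ℕ) : ℝ) := by
  have hterm : ∀ u v x y, 100 * (codegree R u x - c) + cliqueCount R v x y +
      100 * (R u y).toNat - (100 * q + 100) =
        if u = x then (bif R u y then cliqueCount R v x y else 0) else 0 := by
    intro u v x y
    have hle := (cliqueCount_le_card R v x y).trans hV
    rw [hc]
    split <;> cases R u y <;> simp <;> omega
  have hle : ∀ u x, codegree R u x - c ≤ q := fun u x => by
    rw [hc]
    split <;> omega
  simp only [cliqueNet, BloomGraphNet.output]
  rw [multiset_sum_apply, Multiset.map_map]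
  simp only [Function.comp_def, pair_cliqueNet hR hH X hle, hterm]
  change ∑ p : V × V, _ = _
  rw [Fintype.sum_prod_type, Nat.cast_sum]
  refine Finset.sum_congr rfl fun u _ => ?_
  rw [Nat.cast_sum]
  refine Finset.sum_congr rfl fun v _ => congrArg Nat.cast ?_
  rw [Finset.sum_comm]
  simp

theorem cliqueNet_separates (loops : Bool) : ∃ c q, 0 < q ∧
    ∀ R R' : Fin 4 × Fin 4 → Fin 4 × Fin 4 → Bool,
      (R = fun v w => shrikhandeAdj v w || (loops && decide (w = v))) →
      (R' = fun v w => rookAdj v w || (loops && decide (w = v))) →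
      (∀ u x, codegree R u x - c = if u = x then q else 0) ∧
      (∀ u x, codegree R' u x - c = if u = x then q else 0) ∧
      ∑ u, ∑ v, ∑ y, (bif R u y then cliqueCount R v u y else 0) ≠
        ∑ u, ∑ v, ∑ y, (bif R' u y then cliqueCount R' v u y else 0) := by
  cases loops
  -- Each node has codegree 6 with itself and 2 with every other node, so the excess over `c = 2` is
  -- `q = 4`.
  · refine ⟨2, 4, by norm_num, ?_⟩
    rintro R R' rfl rfl
    refine ⟨?_, ?_, ?_⟩ <;> decide +kernel
  -- With loops the codegrees are 7 on the diagonal, 4 for adjacent and 2 for other pairs. The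
  -- degenerate quadruples are equally many in both graphs, as they depend only on the numbers of
  -- nodes, edges and triangles.
  · refine ⟨4, 3, by norm_num, ?_⟩
    rintro R R' rfl rfl
    refine ⟨?_, ?_, ?_⟩ <;> decide +kernel

theorem exists_bloomGraphNet_separates_shrikhande_rook (loops : Bool) (n F : ℕ) :
    ∃ B : BloomGraphNet n F, B.IsNeural ∧
      ∀ (x : Vec F) (H : ZMod 4 × ZMod 4 → Fin n) (H' : Fin 4 × Fin 4 → Fin n),
        H.Injective → H'.Injective →
        B.output loops shrikhande (fun _ => x) H ≠ B.output loops rook (fun _ => x) H' := by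
  obtain ⟨c, q, hq, hcq⟩ := cliqueNet_separates loops
  obtain ⟨h₁, h₂, hne⟩ := hcq _ _ rfl rfl
  refine ⟨cliqueNet n F c q, isNeural_cliqueNet n F c q, fun x H H' hH hH' heq => hne ?_⟩
  have hs := output_cliqueNet (V := Fin 4 × Fin 4) (G := shrikhande) (loops := loops) (H := H)
    (mem_nbhd_iff fun _ _ => shrikhande_adj) hH (fun _ => x) hq h₁ (by simp)
  have hr := output_cliqueNet (G := rook) (loops := loops) (H := H')
    (mem_nbhd_iff fun _ _ => rook_adj) hH' (fun _ => x) hq h₂ (by simp)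
  have := hs.symm.trans (heq.trans hr)
  exact_mod_cast this

end Cliques

end BloomMPNN

theorem mainTheorem4 (loops : Bool) (n F : ℕ) :
    -- every standard MPNN is an MPNN with Bloom signatures
    (∀ M : MPNN F, ∃ B : BloomNet n F 1, (M.IsNeural → B.IsNeural) ∧
      ∀ (V : Type) [Fintype V] (G : SimpleGraph V) (X : V → Vec F) (H : V → Fin n)
        (u v : V), B.score loops G X H u v = M.score loops G X u v) ∧
    -- node pairs that 1-WL tells apart are told apart
    (∀ (V V' : Type) [Fintype V] [Fintype V'] (G : SimpleGraph V) (G' : SimpleGraph V')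
      (X : V → Vec F) (X' : V' → Vec F) (e : V × V) (e' : V' × V'),
      WL1Separates G X e G' X' e' →
      ∃ B : BloomNet n F 1, B.IsNeural ∧
        ∀ (H : V → Fin n) (H' : V' → Fin n),
          B.score loops G X H e.1 e.2 ≠ B.score loops G' X' H' e'.1 e'.2) ∧
    -- the pairs (v₁, v₄), (v₁, v₇) of the 3-regular graph: non-automorphic, automorphic endpoints
    (∀ v, (cubicGraph.neighborSet v).ncard = 3) ∧
    AutNodes cubicGraph 0 0 ∧
    AutNodes cubicGraph 3 6 ∧
    ¬ AutPairs cubicGraph (0, 3) (0, 6) ∧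
    -- neither 1-WL nor any standard MPNN separates them ...
    (∀ x : Vec F,
      ¬ WL1Separates cubicGraph (fun _ => x) (0, 3)
        cubicGraph (fun _ => x) (0, 6) ∧
      ∀ M : MPNN F, M.score loops cubicGraph (fun _ => x) 0 3 =
        M.score loops cubicGraph (fun _ => x) 0 6) ∧
    -- ... but an MPNN with Bloom signatures does, for all hash functions without collisions
    (∃ B : BloomNet n F 1, B.IsNeural ∧
      ∀ (x : Vec F) (H H' : Fin 8 → Fin n), H.Injective → H'.Injective →
        B.score loops cubicGraph (fun _ => x) H 0 3 ≠
          B.score loops cubicGraph (fun _ => x) H' 0 6) ∧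
    -- 3-WL does not distinguish the non-isomorphic Shrikhande and Rook's graphs ...
    IsEmpty (shrikhande ≃g rook) ∧
    WLEquiv 3 shrikhande rook ∧
    -- ... but an MPNN with Bloom signatures does
    (∃ B : BloomGraphNet n F, B.IsNeural ∧
      ∀ (x : Vec F) (H : ZMod 4 × ZMod 4 → Fin n) (H' : Fin 4 × Fin 4 → Fin n),
        H.Injective → H'.Injective →
        B.output loops shrikhande (fun _ => x) H ≠
          B.output loops rook (fun _ => x) H') := by
  refine ⟨fun M => ⟨M.toBloom n, fun hM => MPNN.isNeural_toBloom n hM, fun V _ G X H u v =>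
      MPNN.score_toBloom M loops G X H u v⟩,
    fun V V' _ _ G G' X X' e e' h => exists_bloomNet_separates loops n h,
    ncard_neighborSet_cubicGraph, ⟨RelIso.refl _, rfl⟩, autNodes_cubicGraph,
    not_autPairs_cubicGraph, fun x => ⟨?_, fun M => ?_⟩,
    exists_bloomNet_separates_cubicGraph loops n F, isEmpty_shrikhande_iso_rook,
    wlEquiv_shrikhande_rook, exists_bloomGraphNet_separates_shrikhande_rook loops n F⟩
  · rintro ⟨t, ht⟩
    exact ht (Prod.ext rfl (wl1_cubicGraph_const x t 3 6))
  · simp only [MPNN.score, eval_cubicGraph_const M.layers loops x 3 6]
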